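/- All graphs are finite and simple, and $\mathbb{N}=\{0,1,2,\dots\}$. Let $G$ be a graph and let $f\colon V(G)\to\mathbb{N}$. For $u\in V(G)$, the operation $\mathrm{Delete}(G,f,u)$ outputs the graph $G-u$ and the function $f'\colon V(G-u)\to\mathbb{Z}$ with $f'(v)=f(v)-1$ if $uv\in E(G)$ and $f'(v)=f(v)$ otherwise; it is legal if $f'\ge 0$. For adjacent $u,w\in V(G)$, the operation $\mathrm{DelSave}(G,f,u,w)$ outputs the graph $G-u$ and the function $f'\colon V(G-u)\to\mathbb{Z}$ with $f'(v)=f(v)-1$ if $uv\in E(G)$ and $v\ne w$, and $f'(v)=f(v)$ otherwise; it is legal if $f(u)>f(w)$ and $f'\ge 0$. The graph $G$ is weakly $f$-degenerate if all its vertices can be removed by a sequence of legal applications of $\mathrm{Delete}$ and $\mathrm{DelSave}$, starting from $(G,f)$. The weak degeneracy $\mathsf{wd}(G)$ is the minimum $d\in\mathbb{N}$ such that $G$ is weakly degenerate with respect to the constant function $d$. **Theorem.** For each integer $k\ge 1$, there exist $c>0$ and $d_0\in\mathbb{N}$ such that if $G$ is a graph of maximum degree $d\ge d_0$ with chromatic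 number $\chi(G)\le k$, then $$\mathsf{wd}(G)\le d-c\sqrt{d}.$$ -/

import Mathlib

namespace SimpleGraph

universe u

variable {V : Type u}

open Classical in
/-- The function produced by the operation `Delete (G, f, u)`: every neighbor of `u` loses `1`.
Values are integers; only the values at remaining vertices other than `u` are ever used. -/
noncomputable def deleteFun (G : SimpleGraph V) (f : V → ℤ) (u : V) : V → ℤ :=
  fun v => if G.Adj u v then f v - 1 else f v

open Classical in
/-- The function produced by the operation `DelSave (G, f, u, w)`: every neighbor of `u` other
than `w` loses `1`. -/
noncomputable def delSaveFun (G : SimpleGraph V) (f : V → ℤ) (u w : V) : V → ℤ :=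
  fun v => if G.Adj u v ∧ v ≠ w then f v - 1 else f v

/-- `G.Removable S f`: starting from the induced subgraph `G[S]` and the function `f` on `S`, all
vertices can be removed by a sequence of legal applications of `Delete` and `DelSave`.
Since every graph obtained on the way is an induced subgraph of `G`, it is recorded by the set `S`
of its vertices. An application is legal if the new function is nonnegative on the
remaining vertices and, for `DelSave (G, f, u, w)`, moreover `f u > f w`. -/
inductive Removable (G : SimpleGraph V) : Set V → (V → ℤ) → Prop
  | done (f : V → ℤ) : Removable G ∅ f
  | delete (S : Set V) (f : V → ℤ) (u : V) (hu : u ∈ S)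
      (hnonneg : ∀ v ∈ S \ {u}, 0 ≤ G.deleteFun f u v)
      (hrest : Removable G (S \ {u}) (G.deleteFun f u)) : Removable G S f
  | delSave (S : Set V) (f : V → ℤ) (u w : V) (hu : u ∈ S) (hw : w ∈ S) (huw : G.Adj u w)
      (hlt : f w < f u)
      (hnonneg : ∀ v ∈ S \ {u}, 0 ≤ G.delSaveFun f u w v)
      (hrest : Removable G (S \ {u}) (G.delSaveFun f u w)) : Removable G S f

/-- `G` is weakly `f`-degenerate, for `f : V → ℕ`. -/
def WeaklyDegenerate (G : SimpleGraph V) (f : V → ℕ) : Prop :=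
  G.Removable Set.univ (fun v => (f v : ℤ))

/-- The weak degeneracy of `G`: the minimum `d` such that `G` is weakly `d`-degenerate (the
minimum is attained for every finite graph, see `weaklyDegenerate_weakDegeneracy`). -/
noncomputable def weakDegeneracy (G : SimpleGraph V) : ℕ :=
  sInf {d : ℕ | G.WeaklyDegenerate fun _ => d}

theorem removable_of_ncard_le [Finite V] (G : SimpleGraph V) (n : ℕ) :
    ∀ (S : Set V) (f : V → ℤ), S.ncard = n → (∀ v ∈ S, (n : ℤ) ≤ f v) → G.Removable S f := by
  induction n with
  | zero =>
    intro S f hS _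
    obtain rfl : S = ∅ := (Set.ncard_eq_zero).1 hS
    exact .done f
  | succ n ih =>
    intro S f hS hf
    obtain ⟨u, hu⟩ : S.Nonempty := by
      rw [← Set.ncard_pos, hS]; exact Nat.succ_pos n
    have key : ∀ v ∈ S \ {u}, (n : ℤ) ≤ G.deleteFun f u v := by
      intro v hv
      have := hf v hv.1
      push_cast at this
      unfold deleteFun
      split_ifs <;> omega
    refine .delete S f u hu (fun v hv => le_trans (by positivity) (key v hv)) (ih _ _ ?_ key)
    rw [Set.ncard_sdiff_singleton_of_mem hu, hS, Nat.add_sub_cancel]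

/-- The set whose infimum defines `weakDegeneracy` is nonempty for a finite graph, so the infimum
is a minimum. -/
theorem weaklyDegenerate_weakDegeneracy [Finite V] (G : SimpleGraph V) :
    G.WeaklyDegenerate fun _ => G.weakDegeneracy :=
  Nat.sInf_mem (s := {d : ℕ | G.WeaklyDegenerate fun _ => d})
    ⟨(Set.univ : Set V).ncard, G.removable_of_ncard_le _ _ _ rfl fun _ _ => le_rfl⟩

end SimpleGraph

/-! Fix a proper colouring with `k` colours, let `M` be about `√d` and `s` about `M / (24 k²)`. The
aim is to empty the graph starting from the constant function `d - s`. Each vertex gets a random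
label: with probability `1 / M` it joins a reserve, removed at the very end; otherwise it is removed
in one of `k` random phases. Phase `j` begins with its vertices of colour `j`, in two random halves.

Only vertices of degree above `d - s` can run out. Outside the reserve such a vertex still has at
least `s` reserve neighbours when it is removed, and this suffices. A vertex `w` of that degree
inside the reserve has to be saved `s` times. Let `j` be a most frequent colour around `w`; the
candidates to save `w` are its non-reserve neighbours `u` of colour `j` in the second half of phase
`j`. As `u` has no neighbour of its own colour, it has lost only neighbours from earlier phases,
about a fraction `j / k`. By then `w` has lost about the same fraction, and moreover its neighbours
in the first half, of order `d / k²`. So `u` has the larger value and `DelSave` is legal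
(`BalancedAt.removed_lt`).

There are at least `d / (8 k²)` candidates for `w`, while each `u` is a candidate for at most `3 d /
M` reserve vertices, so Hall's theorem gives all such `w` disjoint sets of `s` savers
(`exists_injective_representatives`). A labelling with these properties at every vertex comes from
Chernoff bounds and the local lemma (`exists_forall_balancedAt`). -/

section ProductSpace

/-! ### Product spaces: the local lemma and Chernoff bounds. -/

open Finset

variable {V A ι : Type*} [Fintype V] [DecidableEq V] [Fintype A] [DecidableEq A]

/-- Events in a finite product space that depend on disjoint sets of coordinates are
independent. -/
theorem card_inter_mul_card_of_dependsOn (T : Finset V) (E F : Finset (V → A))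
    (hE : ∀ ω ω' : V → A, (∀ x ∈ T, ω x = ω' x) → ω ∈ E → ω' ∈ E)
    (hF : ∀ ω ω' : V → A, (∀ x ∉ T, ω x = ω' x) → ω ∈ F → ω' ∈ F) :
    #(E ∩ F) * Fintype.card (V → A) = #E * #F := by
  rw [← Finset.card_univ, ← card_product, ← card_product]
  -- Exchanging the coordinates outside `T` is an involution on pairs, carrying `(E ∩ F) × univ` to
  -- `E × F`.
  let mix : (V → A) → (V → A) → V → A := fun ω ω' x => if x ∈ T then ω x else ω' x
  have h1 : ∀ ω ω', ∀ x ∈ T, ω x = mix ω ω' x := fun ω ω' x hx => by simp [mix, hx]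
  have h2 : ∀ ω ω', ∀ x ∉ T, ω' x = mix ω ω' x := fun ω ω' x hx => by simp [mix, hx]
  refine Finset.card_nbij' (fun q => (mix q.1 q.2, mix q.2 q.1))
    (fun q => (mix q.1 q.2, mix q.2 q.1)) ?_ ?_ ?_ ?_
  · rintro ⟨ω, ω'⟩ h
    simp only [coe_product, Set.mem_prod, mem_coe, mem_inter, mem_univ, and_true] at h ⊢
    exact ⟨hE _ _ (h1 _ _) h.1, hF _ _ (h2 _ _) h.2⟩
  · rintro ⟨ω, ω'⟩ h
    simp only [coe_product, Set.mem_prod, mem_coe, mem_inter, mem_univ, and_true] at h ⊢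
    exact ⟨hE _ _ (h1 _ _) h.1, hF _ _ (h2 _ _) h.2⟩
  · rintro ⟨ω, ω'⟩ _
    ext x <;> by_cases hx : x ∈ T <;> simp [mix, hx]
  · rintro ⟨ω, ω'⟩ _
    ext x <;> by_cases hx : x ∈ T <;> simp [mix, hx]

/-- The points that avoid all the events indexed by `S`. -/
def avoiding (bad : ι → Finset (V → A)) (S : Finset ι) : Finset (V → A) :=
  univ.filter fun ω => ∀ j ∈ S, ω ∉ bad j

/-- Avoiding the events on coordinates disjoint from `dom i` leaves the probability of `bad i`
unchanged. Each of the other, at most `D`, events has conditional probability at most `2 p` by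
induction, so avoiding them too costs at most half of the space, as `2 p D ≤ 1 / 2`. -/
theorem card_bad_inter_avoiding_le [DecidableEq ι] [Fintype ι] (bad : ι → Finset (V → A))
    (dom : ι → Finset V)
    (hdep : ∀ i (ω ω' : V → A), (∀ x ∈ dom i, ω x = ω' x) → ω ∈ bad i → ω' ∈ bad i)
    (D : ℕ) (hD : ∀ i, #{j | ¬ Disjoint (dom i) (dom j)} ≤ D) (p : ℝ) (hp0 : 0 ≤ p)
    (hp : ∀ i, (#(bad i) : ℝ) ≤ p * Fintype.card (V → A)) (hpD : 4 * p * D ≤ 1)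
    (S : Finset ι) : ∀ i, (#(bad i ∩ avoiding bad S) : ℝ) ≤ 2 * p * #(avoiding bad S) := by
  induction S using Finset.strongInduction with
  | H S ih =>
  intro i
  set S₁ := S.filter fun j => ¬ Disjoint (dom i) (dom j)
  set S₂ := S.filter fun j => Disjoint (dom i) (dom j)
  have hind : (#(bad i ∩ avoiding bad S₂) : ℝ) ≤ p * #(avoiding bad S₂) := by
    have h := card_inter_mul_card_of_dependsOn (dom i) (bad i) (avoiding bad S₂) (hdep i) (by
      intro ω ω' hω hmem
      simp only [avoiding, mem_filter, mem_univ, true_and] at hmem ⊢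
      intro j hj hb
      refine hmem j hj (hdep j ω' ω (fun x hx => (hω x ?_).symm) hb)
      exact fun hxi => Finset.disjoint_left.1 (mem_filter.1 hj).2 hxi hx)
    have h' : (#(bad i ∩ avoiding bad S₂) : ℝ) * Fintype.card (V → A)
        = #(bad i) * #(avoiding bad S₂) := by exact_mod_cast h
    rcases Nat.eq_zero_or_pos (Fintype.card (V → A)) with h0 | hpos
    · have : #(bad i ∩ avoiding bad S₂) = 0 := by
        have := Finset.card_le_univ (bad i ∩ avoiding bad S₂); omega
      rw [this, Nat.cast_zero]; positivity
    · have hpos' : (0 : ℝ) < Fintype.card (V → A) := by exact_mod_cast hpos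
      refine le_of_mul_le_mul_right ?_ hpos'
      rw [h']
      have := mul_le_mul_of_nonneg_right (hp i) (Nat.cast_nonneg (α := ℝ) #(avoiding bad S₂))
      linarith
  have hsub : avoiding bad S ⊆ avoiding bad S₂ := by
    intro ω h
    simp only [avoiding, mem_filter, mem_univ, true_and] at h ⊢
    exact fun j hj => h j (mem_filter.1 hj).1
  have hle : (#(bad i ∩ avoiding bad S) : ℝ) ≤ #(bad i ∩ avoiding bad S₂) := by
    exact_mod_cast card_le_card (inter_subset_inter_left hsub)
  suffices h : (#(avoiding bad S₂) : ℝ) ≤ 2 * #(avoiding bad S) by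
    have := mul_le_mul_of_nonneg_left h hp0
    linarith
  by_cases hS : S₂ = S
  · rw [hS]; linarith [Nat.cast_nonneg (α := ℝ) #(avoiding bad S)]
  have hlt : S₂ ⊂ S := (filter_subset _ _).ssubset_of_ne hS
  have hcover : avoiding bad S₂ ⊆
      avoiding bad S ∪ S₁.biUnion fun j => bad j ∩ avoiding bad S₂ := by
    intro ω h
    by_cases hω : ω ∈ avoiding bad S
    · exact mem_union_left _ hω
    · refine mem_union_right _ ?_
      have h' := h
      simp only [avoiding, mem_filter, mem_univ, true_and, not_forall, not_not] at hω h'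
      obtain ⟨j, hj, hb⟩ := hω
      refine mem_biUnion.2 ⟨j, ?_, mem_inter.2 ⟨hb, h⟩⟩
      exact mem_filter.2 ⟨hj, fun hd => h' j (mem_filter.2 ⟨hj, hd⟩) hb⟩
  have hcard : (#(avoiding bad S₂) : ℝ) ≤
      #(avoiding bad S) + ∑ j ∈ S₁, (#(bad j ∩ avoiding bad S₂) : ℝ) := by
    exact_mod_cast (card_le_card hcover).trans
      ((card_union_le _ _).trans (Nat.add_le_add_left card_biUnion_le _))
  have hsum : ∑ j ∈ S₁, (#(bad j ∩ avoiding bad S₂) : ℝ) ≤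
      D * (2 * p * #(avoiding bad S₂)) := by
    refine (sum_le_card_nsmul _ _ _ fun j _ => ih S₂ hlt j).trans ?_
    rw [nsmul_eq_mul]
    refine mul_le_mul_of_nonneg_right ?_ (by positivity)
    exact_mod_cast (card_le_card (filter_subset_filter _ (subset_univ S))).trans (hD i)
  have := mul_le_mul_of_nonneg_right hpD (Nat.cast_nonneg (α := ℝ) #(avoiding bad S₂))
  nlinarith

/-- The symmetric Lovász local lemma in a finite product space. -/
theorem exists_forall_notMem_of_local [DecidableEq ι] [Fintype ι] [Nonempty A]
    (bad : ι → Finset (V → A)) (dom : ι → Finset V)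
    (hdep : ∀ i (ω ω' : V → A), (∀ x ∈ dom i, ω x = ω' x) → ω ∈ bad i → ω' ∈ bad i)
    (D : ℕ) (hD : ∀ i, #{j | ¬ Disjoint (dom i) (dom j)} ≤ D) (p : ℝ) (hp0 : 0 ≤ p)
    (hp1 : 2 * p < 1)
    (hp : ∀ i, (#(bad i) : ℝ) ≤ p * Fintype.card (V → A)) (hpD : 4 * p * D ≤ 1) :
    ∃ ω : V → A, ∀ i, ω ∉ bad i := by
  have key : ∀ S : Finset ι, (0 : ℝ) < #(avoiding bad S) := by
    intro S
    induction S using Finset.induction_on with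
    | empty => simp [avoiding, Fintype.card_pos]
    | insert i S _ ih =>
      have h := card_bad_inter_avoiding_le bad dom hdep D hD p hp0 hp hpD S i
      have hc : avoiding bad S ⊆ avoiding bad (insert i S) ∪ (bad i ∩ avoiding bad S) := by
        intro ω hω
        by_cases hb : ω ∈ bad i
        · exact mem_union_right _ (mem_inter.2 ⟨hb, hω⟩)
        · refine mem_union_left _ ?_
          simp only [avoiding, mem_filter, mem_univ, true_and, forall_mem_insert] at hω ⊢
          exact ⟨hb, hω⟩
      have hc' : (#(avoiding bad S) : ℝ) ≤
          #(avoiding bad (insert i S)) + #(bad i ∩ avoiding bad S) := by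
        exact_mod_cast (card_le_card hc).trans (card_union_le _ _)
      nlinarith
  obtain ⟨ω, hω⟩ := Finset.card_pos.1 (Nat.cast_pos.1 (key univ))
  simp only [avoiding, mem_filter, mem_univ, true_and, forall_const] at hω
  exact ⟨ω, hω⟩

/-- The moment generating function of the number of coordinates in `T` whose value lies in `B`. -/
theorem sum_exp_mul_card_le (T : Finset V) (B : Finset A) (q l : ℝ)
    (hq : (#B : ℝ) = q * Fintype.card A) (hq0 : 0 ≤ q) (hl : |l| ≤ 1) :
    ∑ ω : V → A, Real.exp (l * #{v ∈ T | ω v ∈ B}) ≤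
      Real.exp (#T * (q * (l + l ^ 2))) * Fintype.card (V → A) := by
  let g : V → A → ℝ := fun v a => if v ∈ T then (if a ∈ B then Real.exp l else 1) else 1
  have h1 : ∀ ω : V → A, Real.exp (l * #{v ∈ T | ω v ∈ B}) = ∏ v, g v (ω v) := by
    intro ω
    simp only [g]
    rw [Finset.prod_ite_mem, univ_inter, Finset.prod_ite, prod_const, prod_const_one, mul_one,
      mul_comm, Real.exp_nat_mul]
  have h2 : ∀ v, ∑ a, g v a ≤
      (if v ∈ T then Real.exp (q * (l + l ^ 2)) else 1) * Fintype.card A := by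
    intro v
    by_cases hv : v ∈ T
    · simp only [g, hv, if_true]
      have he : Real.exp l ≤ 1 + l + l ^ 2 := by
        have := (abs_le.1 (Real.abs_exp_sub_one_sub_id_le hl)).2; linarith
      have hs : ∑ a, (if a ∈ B then Real.exp l else 1)
          = (1 + q * (Real.exp l - 1)) * Fintype.card A := by
        have : ∀ a, (if a ∈ B then Real.exp l else 1)
            = 1 + (if a ∈ B then Real.exp l - 1 else 0) := fun a => by split_ifs <;> ring
        simp only [this, sum_add_distrib, Finset.sum_ite_mem, univ_inter, sum_const, nsmul_eq_mul,
          card_univ, hq]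
        ring
      rw [hs]
      refine mul_le_mul_of_nonneg_right ?_ (Nat.cast_nonneg _)
      have h3 := Real.add_one_le_exp (q * (l + l ^ 2))
      nlinarith
    · simp [g, hv]
  simp only [h1]
  rw [← Fintype.prod_sum]
  calc ∏ v, ∑ a, g v a
      ≤ ∏ v, ((if v ∈ T then Real.exp (q * (l + l ^ 2)) else 1) * (Fintype.card A : ℝ)) := by
        refine prod_le_prod (fun v _ => sum_nonneg fun a _ => ?_) fun v _ => h2 v
        simp only [g]; split_ifs <;> positivity
    _ = _ := by
        rw [prod_mul_distrib, Finset.prod_ite_mem, univ_inter, prod_const, prod_const,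
          ← Real.exp_nat_mul, Fintype.card_fun, card_univ]
        push_cast; ring

/-- A Chernoff bound, for both tails according to the sign of `l`. -/
theorem card_tail_le (T : Finset V) (B : Finset A) (q l t : ℝ)
    (hq : (#B : ℝ) = q * Fintype.card A) (hq0 : 0 ≤ q) (hl : |l| ≤ 1) :
    (#{ω : V → A | l * (q * #T) + t ≤ l * #{v ∈ T | ω v ∈ B}} : ℝ) ≤
      Real.exp (q * #T * l ^ 2 - t) * Fintype.card (V → A) := by
  set X := (univ : Finset (V → A)).filter
    fun ω => l * (q * #T) + t ≤ l * (#{v ∈ T | ω v ∈ B} : ℝ)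
  have h1 : (#X : ℝ) * Real.exp (l * (q * #T) + t) ≤
      ∑ ω : V → A, Real.exp (l * #{v ∈ T | ω v ∈ B}) := by
    rw [← nsmul_eq_mul]
    refine (card_nsmul_le_sum X _ _ fun ω hω => Real.exp_le_exp.2 (mem_filter.1 hω).2).trans ?_
    exact sum_le_sum_of_subset_of_nonneg (subset_univ _) fun _ _ _ => (Real.exp_pos _).le
  have h2 := h1.trans (sum_exp_mul_card_le T B q l hq hq0 hl)
  refine le_of_mul_le_mul_right (h2.trans_eq ?_) (Real.exp_pos (l * (q * #T) + t))
  rw [mul_right_comm, ← Real.exp_add]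
  congr 2; ring

end ProductSpace

namespace SimpleGraph

open Finset

/-! ### Removal sequences prescribed by a time function. -/

section Schedule

variable {V : Type*} [Fintype V] [DecidableEq V] (G : SimpleGraph V) [DecidableRel G.Adj]

/-- The value at `v` once the vertices outside `S` have been removed, where the removal of `u`
saves the vertex `sav u`, if any. -/
def scheduleFun (f : V → ℤ) (sav : V → Option V) (S : Finset V) (v : V) : ℤ :=
  f v - #{x | G.Adj v x ∧ x ∉ S} + #{x | sav x = some v ∧ x ∉ S}

theorem scheduleFun_erase (f : V → ℤ) (sav : V → Option V) (S : Finset V) (u : V) (hu : u ∈ S)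
    (v : V) : G.scheduleFun f sav (S.erase u) v =
      G.scheduleFun f sav S v - (if G.Adj u v then 1 else 0)
        + (if sav u = some v then 1 else 0) := by
  have key : ∀ (P : V → Prop) [DecidablePred P],
      (#{x | P x ∧ x ∉ S.erase u} : ℤ) = #{x | P x ∧ x ∉ S} + (if P u then 1 else 0) := by
    intro P _
    by_cases hP : P u
    · have : (univ.filter fun x => P x ∧ x ∉ S.erase u)
          = insert u (univ.filter fun x => P x ∧ x ∉ S) := by
        ext x
        simp only [mem_filter, mem_univ, true_and, mem_erase, mem_insert]
        by_cases hx : x = u <;> simp [hx, hP]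
      rw [this, card_insert_of_notMem (by simp [hu])]
      simp [hP]
    · rw [if_neg hP, add_zero]
      congr 2
      ext x
      simp only [mem_filter, mem_univ, true_and, mem_erase]
      by_cases hx : x = u <;> simp [hx, hP]
  simp only [scheduleFun]
  rw [key (fun x => G.Adj v x), key (fun x => sav x = some v)]
  simp only [G.adj_comm v u]
  ring

/-- Vertices leave in the order of `τ` with ties broken arbitrarily, so the conditions range over
every set `S` that can remain. The strict inequality in `hadj` ensures that a vertex is still
present when it is saved. -/
theorem removable_of_schedule (τ : V → ℕ) (f : V → ℤ) (sav : V → Option V)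
    (hadj : ∀ u w, sav u = some w → G.Adj u w ∧ τ u < τ w)
    (hnonneg : ∀ S : Finset V, (∀ x ∉ S, ∀ y ∈ S, τ x ≤ τ y) →
      ∀ v ∈ S, 0 ≤ G.scheduleFun f sav S v)
    (hlt : ∀ S : Finset V, (∀ x ∉ S, ∀ y ∈ S, τ x ≤ τ y) → ∀ u ∈ S, (∀ y ∈ S, τ u ≤ τ y) →
      ∀ w, sav u = some w → G.scheduleFun f sav S w < G.scheduleFun f sav S u)
    (S : Finset V) (hS : ∀ x ∉ S, ∀ y ∈ S, τ x ≤ τ y) :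
    G.Removable S (G.scheduleFun f sav S) := by
  induction S using Finset.strongInduction with
  | H S ih =>
  rcases S.eq_empty_or_nonempty with rfl | hne
  · simpa using Removable.done _
  obtain ⟨u, hu, hmin⟩ := exists_min_image S τ hne
  have hS' : ∀ x ∉ S.erase u, ∀ y ∈ S.erase u, τ x ≤ τ y := by
    intro x hx y hy
    by_cases hxu : x = u
    · exact hxu ▸ hmin y (mem_of_mem_erase hy)
    · exact hS x (fun h => hx (mem_erase.2 ⟨hxu, h⟩)) y (mem_of_mem_erase hy)
  have hrest := ih _ (erase_ssubset hu) hS'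
  have hn : ∀ v ∈ (S : Set V) \ {u}, 0 ≤ G.scheduleFun f sav (S.erase u) v :=
    fun v hv => hnonneg _ hS' v (mem_erase.2 ⟨hv.2, hv.1⟩)
  rw [coe_erase] at hrest
  cases hsav : sav u with
  | none =>
    have hfun : G.deleteFun (G.scheduleFun f sav S) u = G.scheduleFun f sav (S.erase u) := by
      funext v
      rw [scheduleFun_erase G f sav S u hu v, hsav]
      simp only [deleteFun]
      split_ifs <;> simp_all
    exact .delete _ _ u hu (hfun ▸ hn) (hfun ▸ hrest)
  | some w =>
    obtain ⟨hadjw, hτ⟩ := hadj u w hsav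
    have hw : w ∈ S := by
      by_contra hw
      exact absurd (hS w hw u hu) (by omega)
    have hfun : G.delSaveFun (G.scheduleFun f sav S) u w
        = G.scheduleFun f sav (S.erase u) := by
      funext v
      rw [scheduleFun_erase G f sav S u hu v, hsav]
      simp only [delSaveFun, Option.some.injEq]
      by_cases hv : v = w
      · subst hv; simp [hadjw]
      · simp [hv, Ne.symm hv]; split_ifs <;> ring
    exact .delSave _ _ u w hu hw hadjw (hlt S hS u hu hmin w hsav) (hfun ▸ hn) (hfun ▸ hrest)

end Schedule

end SimpleGraph

namespace SimpleGraph

open Finset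

/-! ### Existence of a balanced labelling. -/

section Labelling

variable {V : Type*} [Fintype V] (G : SimpleGraph V) [DecidableRel G.Adj]
variable {k M : ℕ}

/-- The labels `ω x = (m, y, h)` are evenly distributed among the neighbors of `v`. Vertices with
`m = 0` form the reserve, `y` is a phase, and `h` a half of that phase. -/
structure BalancedAt (col : V → Fin k) (d : ℕ) (v : V) (ω : V → Fin M × Fin k × Bool) :
    Prop where
  reserve_le : (#{x ∈ G.neighborFinset v | (ω x).1.val = 0} : ℝ) ≤ 3 * (d / M)
  le_reserve : (d : ℝ) ≤ 2 * G.degree v →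
    (d / M / 8 : ℝ) ≤ #{x ∈ G.neighborFinset v | (ω x).1.val = 0}
  early_le (j : Fin k) : (#{x ∈ G.neighborFinset v | (ω x).2.1 < j} : ℝ) ≤
    (j.val / k : ℝ) * G.degree v + d / (32 * k ^ 2)
  le_early (j : Fin k) : (j.val / k : ℝ) * G.degree v - d / (32 * k ^ 2) ≤
    #{x ∈ G.neighborFinset v | (ω x).2.1 < j}
  le_class (j : Fin k) (h : Bool) :
    (1 / (2 * k) : ℝ) * #{x ∈ G.neighborFinset v | col x = j} - d / (32 * k ^ 2) ≤
      #{x ∈ {x ∈ G.neighborFinset v | col x = j} | (ω x).2.1 = j ∧ (ω x).2.2 = h}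

theorem card_label_reserve (hM : 0 < M) :
    (#{a : Fin M × Fin k × Bool | a.1.val = 0} : ℝ) =
      (1 / M : ℝ) * Fintype.card (Fin M × Fin k × Bool) := by
  have : (univ.filter fun a : Fin M × Fin k × Bool => a.1.val = 0)
      = {(⟨0, hM⟩ : Fin M)} ×ˢ univ := by
    ext ⟨a, b, c⟩; simp [Fin.ext_iff, eq_comm]
  rw [this, card_product]
  simp only [card_singleton, card_univ, Fintype.card_prod, Fintype.card_fin, Fintype.card_bool]
  have : (M : ℝ) ≠ 0 := by positivity
  push_cast; field_simp

theorem card_label_early (hk : 0 < k) (j : Fin k) :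
    (#{a : Fin M × Fin k × Bool | a.2.1 < j} : ℝ) =
      (j.val / k : ℝ) * Fintype.card (Fin M × Fin k × Bool) := by
  have : (univ.filter fun a : Fin M × Fin k × Bool => a.2.1 < j)
      = univ ×ˢ (Finset.Iio j ×ˢ univ) := by
    ext a; simp
  rw [this, card_product, card_product]
  simp only [card_univ, Fintype.card_prod, Fintype.card_fin, Fintype.card_bool, Fin.card_Iio]
  have : (k : ℝ) ≠ 0 := by positivity
  push_cast; field_simp

theorem card_label_class (hk : 0 < k) (j : Fin k) (h : Bool) :
    (#{a : Fin M × Fin k × Bool | a.2.1 = j ∧ a.2.2 = h} : ℝ) =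
      (1 / (2 * k) : ℝ) * Fintype.card (Fin M × Fin k × Bool) := by
  have : (univ.filter fun a : Fin M × Fin k × Bool => a.2.1 = j ∧ a.2.2 = h)
      = univ ×ˢ ({j} ×ˢ {h}) := by
    ext ⟨a, b, c⟩; simp [eq_comm]
  rw [this, card_product, card_product]
  simp only [card_univ, Fintype.card_prod, Fintype.card_fin, Fintype.card_bool, card_singleton]
  have : (k : ℝ) ≠ 0 := by positivity
  push_cast; field_simp

/-- A consequence of `card_tail_le` for an event implying a deviation. -/
theorem card_filter_le_of_tail [DecidableEq V] {A : Type*} [Fintype A] [DecidableEq A]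
    (T : Finset V) (P : A → Prop) [DecidablePred P] (E : Finset (V → A)) (q l t r : ℝ)
    (hq : (#{a | P a} : ℝ) = q * Fintype.card A) (hq0 : 0 ≤ q) (hl : |l| ≤ 1)
    (hE : ∀ ω ∈ E, l * (q * #T) + t ≤ l * #{v ∈ T | P (ω v)})
    (hr : q * #T * l ^ 2 - t ≤ r) :
    (#E : ℝ) ≤ Real.exp r * Fintype.card (V → A) := by
  have h := card_tail_le T (univ.filter P) q l t hq hq0 hl
  simp only [mem_filter, mem_univ, true_and] at h
  refine le_trans ?_ (h.trans (mul_le_mul_of_nonneg_right (Real.exp_le_exp.2 hr)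
    (Nat.cast_nonneg _)))
  exact_mod_cast card_le_card fun ω hω => mem_filter.2 ⟨mem_univ _, hE ω hω⟩

-- A union bound over `4 k + 2` tail events, four for each colour and two for the reserve.
set_option maxHeartbeats 600000 in
theorem card_not_balancedAt_le [DecidableEq V] (col : V → Fin k) (d : ℕ) (v : V)
    [DecidablePred fun ω : V → Fin M × Fin k × Bool => ¬ G.BalancedAt col d v ω] (hk : 0 < k)
    (hM : 256 * k ^ 4 ≤ M) (hMd : M ^ 2 ≤ d) (hd : G.degree v ≤ d) :
    (#(univ.filter fun ω : V → Fin M × Fin k × Bool => ¬ G.BalancedAt col d v ω) : ℝ) ≤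
      ((4 * k + 2) * Real.exp (-(M / 16))) * Fintype.card (V → Fin M × Fin k × Bool) := by
  have hk' : (0 : ℝ) < k := by exact_mod_cast hk
  have hMpos : 0 < M := lt_of_lt_of_le (by positivity) hM
  have hM' : (0 : ℝ) < M := by exact_mod_cast hMpos
  have hMR : (256 * k ^ 4 : ℝ) ≤ M := by exact_mod_cast hM
  have hMdR : (M ^ 2 : ℝ) ≤ d := by exact_mod_cast hMd
  have hdR : (G.degree v : ℝ) ≤ d := by exact_mod_cast hd
  have hMd1 : (M : ℝ) ≤ d / M := by rw [le_div_iff₀ hM']; nlinarith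
  have hcardN : #(G.neighborFinset v) = G.degree v := G.card_neighborFinset_eq_degree v
  set N := G.neighborFinset v with hN
  generalize hΩ : Fintype.card (V → Fin M × Fin k × Bool) = Ω
  set ε : ℝ := 1 / (32 * k ^ 2) with hε
  have hε0 : 0 < ε := by positivity
  have hε1 : ε ≤ 1 := by
    rw [hε, div_le_one (by positivity)]
    have : (1 : ℝ) ≤ k ^ 2 := by exact_mod_cast Nat.one_le_pow _ _ hk
    linarith
  have hεd : (d / (32 * k ^ 2) : ℝ) = ε * d := by rw [hε]; ring
  -- This is what `256 k⁴ ≤ M` is for: a deviation `ε d` costs `ε² d / 4` in the exponent.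
  have hεM : (M / 16 : ℝ) ≤ ε ^ 2 * d / 4 := by
    have h1 : ε ^ 2 * (256 * k ^ 4) = 1 / 4 := by rw [hε]; field_simp; norm_num
    have h2 : ε ^ 2 * (256 * k ^ 4) * M ≤ ε ^ 2 * d := by
      rw [mul_assoc]
      refine mul_le_mul_of_nonneg_left ?_ (by positivity)
      nlinarith
    rw [h1] at h2; linarith
  have habs : |ε / 2| ≤ 1 := by rw [abs_of_pos (by positivity)]; linarith
  have habs' : |-(ε / 2)| ≤ 1 := by rwa [abs_neg]
  have mid : ∀ (q n : ℝ), 0 ≤ q → q ≤ 1 → 0 ≤ n → n ≤ d →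
      q * n * (ε / 2) ^ 2 - ε / 2 * (ε * d) ≤ -(M / 16) := by
    intro q n hq0 hq1 hn0 hn
    have h1 : q * n ≤ d := by nlinarith
    have h2 : q * n * (ε / 2) ^ 2 ≤ d * (ε / 2) ^ 2 :=
      mul_le_mul_of_nonneg_right h1 (by positivity)
    nlinarith
  have hE1 : (#{ω : V → Fin M × Fin k × Bool |
      ¬ (#{x ∈ N | (ω x).1.val = 0} : ℝ) ≤ 3 * (d / M)} : ℝ) ≤
        Real.exp (-(M / 16)) * Ω := by
    have hqn : (1 / M : ℝ) * #N ≤ d / M := by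
      rw [hcardN, one_div_mul_eq_div]; gcongr
    rw [← hΩ]
    refine card_filter_le_of_tail N (fun a : Fin M × Fin k × Bool => a.1.val = 0)
        _ (1 / M) 1 (2 * (d / M)) _
      (card_label_reserve (k := k) hMpos) (by positivity) (by simp) ?_ (by linarith)
    intro ω hω
    replace hω := (mem_filter.1 hω).2
    push Not at hω
    linarith
  have hE2 : (#{ω : V → Fin M × Fin k × Bool |
      ¬ ((d : ℝ) ≤ 2 * G.degree v → (d / M / 8 : ℝ) ≤ #{x ∈ N | (ω x).1.val = 0})} : ℝ) ≤
        Real.exp (-(M / 16)) * Ω := by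
    by_cases hdeg : (d : ℝ) ≤ 2 * G.degree v
    · have hqn : (d / M : ℝ) ≤ 2 * ((1 / M : ℝ) * #N) := by
        rw [hcardN, one_div_mul_eq_div, ← mul_div_assoc]; gcongr
      rw [← hΩ]
      -- With mean `μ ≥ d / (2 M)`, the event puts the count below `μ / 4`; the exponent is `μ / 4 -
      -- 3 μ / 8 = -μ / 8 ≤ -M / 16`.
      refine card_filter_le_of_tail N (fun a : Fin M × Fin k × Bool => a.1.val = 0)
        _ (1 / M) (-(1 / 2))
        (3 / 8 * ((1 / M : ℝ) * #N)) _
        (card_label_reserve (k := k) hMpos) (by positivity) (by norm_num [abs_le]) ?_ (by linarith)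
      intro ω hω
      replace hω := (mem_filter.1 hω).2
      push Not at hω
      linarith [hω.2]
    · simp only [hdeg, false_imp_iff, not_true_eq_false, filter_false, card_empty, Nat.cast_zero]
      positivity
  have hjk : ∀ j : Fin k, (j.val / k : ℝ) ≤ 1 := fun j => by
    rw [div_le_one hk']; exact_mod_cast j.2.le
  have hE3 : ∀ j : Fin k, (#{ω : V → Fin M × Fin k × Bool |
      ¬ (#{x ∈ N | (ω x).2.1 < j} : ℝ) ≤
        (j.val / k : ℝ) * G.degree v + d / (32 * k ^ 2)} : ℝ) ≤ Real.exp (-(M / 16)) * Ω := by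
    intro j
    rw [← hΩ]
    refine card_filter_le_of_tail N (fun a : Fin M × Fin k × Bool => a.2.1 < j)
      _ (j.val / k) (ε / 2)
      (ε / 2 * (ε * d)) _ (card_label_early (M := M) hk j) (by positivity) habs ?_
      (mid _ _ (by positivity) (hjk j) (by positivity) (by rwa [hcardN]))
    intro ω hω
    replace hω := (mem_filter.1 hω).2
    push Not at hω
    rw [hεd] at hω
    rw [hcardN, ← mul_add]
    exact mul_le_mul_of_nonneg_left hω.le (by positivity)
  have hE4 : ∀ j : Fin k, (#{ω : V → Fin M × Fin k × Bool |
      ¬ (j.val / k : ℝ) * G.degree v - d / (32 * k ^ 2) ≤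
        #{x ∈ N | (ω x).2.1 < j}} : ℝ) ≤ Real.exp (-(M / 16)) * Ω := by
    intro j
    rw [← hΩ]
    refine card_filter_le_of_tail N (fun a : Fin M × Fin k × Bool => a.2.1 < j)
      _ (j.val / k) (-(ε / 2))
      (ε / 2 * (ε * d)) _ (card_label_early (M := M) hk j) (by positivity) habs' ?_
      (by rw [neg_sq]; exact mid _ _ (by positivity) (hjk j) (by positivity) (by rwa [hcardN]))
    intro ω hω
    replace hω := (mem_filter.1 hω).2
    push Not at hω
    rw [hεd] at hω
    rw [hcardN]
    have := mul_le_mul_of_nonneg_left hω.le (show (0 : ℝ) ≤ ε / 2 by positivity)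
    linarith
  have hE5 : ∀ (j : Fin k) (h : Bool), (#{ω : V → Fin M × Fin k × Bool |
      ¬ (1 / (2 * k) : ℝ) * #{x ∈ N | col x = j} - d / (32 * k ^ 2) ≤
      #{x ∈ {x ∈ N | col x = j} | (ω x).2.1 = j ∧ (ω x).2.2 = h}} : ℝ) ≤
        Real.exp (-(M / 16)) * Ω := by
    intro j h
    have hle : (#{x ∈ N | col x = j} : ℝ) ≤ d := by
      refine le_trans ?_ hdR
      rw [← hcardN]
      exact_mod_cast card_filter_le _ _
    have hq1 : (1 / (2 * k) : ℝ) ≤ 1 := by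
      rw [div_le_one (by positivity)]
      have : (1 : ℝ) ≤ k := by exact_mod_cast hk
      linarith
    rw [← hΩ]
    refine card_filter_le_of_tail {x ∈ N | col x = j}
      (fun a : Fin M × Fin k × Bool => a.2.1 = j ∧ a.2.2 = h) _
      (1 / (2 * k)) (-(ε / 2))
      (ε / 2 * (ε * d)) _ (card_label_class (M := M) hk j h) (by positivity) habs' ?_
      (by rw [neg_sq]; exact mid _ _ (by positivity) hq1 (by positivity) hle)
    intro ω hω
    replace hω := (mem_filter.1 hω).2
    push Not at hω
    rw [hεd] at hω
    have := mul_le_mul_of_nonneg_left hω.le (show (0 : ℝ) ≤ ε / 2 by positivity)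
    linarith
  set E1 := univ.filter fun ω : V → Fin M × Fin k × Bool =>
      ¬ (#{x ∈ N | (ω x).1.val = 0} : ℝ) ≤ 3 * (d / M)
  set E2 := univ.filter fun ω : V → Fin M × Fin k × Bool =>
      ¬ ((d : ℝ) ≤ 2 * G.degree v → (d / M / 8 : ℝ) ≤ #{x ∈ N | (ω x).1.val = 0})
  set E3 := fun j : Fin k => univ.filter fun ω : V → Fin M × Fin k × Bool =>
      ¬ (#{x ∈ N | (ω x).2.1 < j} : ℝ) ≤ (j.val / k : ℝ) * G.degree v + d / (32 * k ^ 2)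
  set E4 := fun j : Fin k => univ.filter fun ω : V → Fin M × Fin k × Bool =>
      ¬ (j.val / k : ℝ) * G.degree v - d / (32 * k ^ 2) ≤ #{x ∈ N | (ω x).2.1 < j}
  set E5 := fun (h : Bool) (j : Fin k) => univ.filter fun ω : V → Fin M × Fin k × Bool =>
      ¬ (1 / (2 * k) : ℝ) * #{x ∈ N | col x = j} - d / (32 * k ^ 2) ≤
      #{x ∈ {x ∈ N | col x = j} | (ω x).2.1 = j ∧ (ω x).2.2 = h}
  have hcover : (univ.filter fun ω : V → Fin M × Fin k × Bool => ¬ G.BalancedAt col d v ω) ⊆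
      E1 ∪ (E2 ∪ univ.biUnion fun j => E3 j ∪ (E4 j ∪ (E5 true j ∪ E5 false j))) := by
    intro ω hω
    by_contra hcon
    simp only [mem_union, mem_biUnion, mem_univ, true_and, not_or, not_exists] at hcon
    obtain ⟨h1, h2, h3⟩ := hcon
    refine (mem_filter.1 hω).2 ⟨?_, ?_, fun j => ?_, fun j => ?_, fun j h => ?_⟩
    · exact not_not.1 fun hc => h1 (mem_filter.2 ⟨mem_univ _, hc⟩)
    · exact not_not.1 fun hc => h2 (mem_filter.2 ⟨mem_univ _, hc⟩)
    · exact not_not.1 fun hc => (h3 j).1 (mem_filter.2 ⟨mem_univ _, hc⟩)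
    · exact not_not.1 fun hc => (h3 j).2.1 (mem_filter.2 ⟨mem_univ _, hc⟩)
    · cases h
      · exact not_not.1 fun hc => (h3 j).2.2.2 (mem_filter.2 ⟨mem_univ _, hc⟩)
      · exact not_not.1 fun hc => (h3 j).2.2.1 (mem_filter.2 ⟨mem_univ _, hc⟩)
  have hcard : (#(univ.filter fun ω : V → Fin M × Fin k × Bool =>
      ¬ G.BalancedAt col d v ω) : ℝ) ≤
      #E1 + (#E2 + ∑ j, ((#(E3 j) : ℝ) + (#(E4 j) + (#(E5 true j) + #(E5 false j))))) := by
    have h1 : ∀ j, #(E3 j ∪ (E4 j ∪ (E5 true j ∪ E5 false j))) ≤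
        #(E3 j) + (#(E4 j) + (#(E5 true j) + #(E5 false j))) := fun j =>
      (card_union_le _ _).trans (Nat.add_le_add_left ((card_union_le _ _).trans
        (Nat.add_le_add_left (card_union_le _ _) _)) _)
    have h2 := (card_le_card hcover).trans ((card_union_le _ _).trans
      (Nat.add_le_add_left ((card_union_le _ _).trans
        (Nat.add_le_add_left (card_biUnion_le.trans (sum_le_sum fun j _ => h1 j)) _)) _))
    exact_mod_cast h2
  refine hcard.trans ?_
  have hsum : ∑ j, ((#(E3 j) : ℝ) + (#(E4 j) + (#(E5 true j) + #(E5 false j)))) ≤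
      k * (4 * (Real.exp (-(M / 16)) * Ω)) := by
    refine (sum_le_card_nsmul _ _ (4 * (Real.exp (-(M / 16)) * Ω)) fun j _ => ?_).trans_eq ?_
    · linarith [hE3 j, hE4 j, hE5 j true, hE5 j false]
    · rw [card_univ, Fintype.card_fin, nsmul_eq_mul]
  linarith

theorem BalancedAt.congr {G : SimpleGraph V} [DecidableRel G.Adj] {col : V → Fin k} {d : ℕ}
    {v : V} {ω ω' : V → Fin M × Fin k × Bool} (h : ∀ x ∈ G.neighborFinset v, ω x = ω' x)
    (hω : G.BalancedAt col d v ω) : G.BalancedAt col d v ω' := by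
  have key : ∀ (T : Finset V), T ⊆ G.neighborFinset v →
      ∀ (P : Fin M × Fin k × Bool → Prop) [DecidablePred P],
      #{x ∈ T | P (ω' x)} = #{x ∈ T | P (ω x)} := by
    intro T hT P _
    congr 1
    exact filter_congr fun x hx => by rw [h x (hT hx)]
  constructor
  · rw [key _ Subset.rfl (fun a => a.1.val = 0)]; exact hω.reserve_le
  · rw [key _ Subset.rfl (fun a => a.1.val = 0)]; exact hω.le_reserve
  · intro j; rw [key _ Subset.rfl (fun a => a.2.1 < j)]; exact hω.early_le j
  · intro j; rw [key _ Subset.rfl (fun a => a.2.1 < j)]; exact hω.le_early j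
  · intro j b
    rw [key _ (filter_subset _ _) (fun a => a.2.1 = j ∧ a.2.2 = b)]; exact hω.le_class j b

theorem card_common_neighbor_le [DecidableEq V] (d : ℕ) (hd : ∀ v, G.degree v ≤ d) (v : V) :
    #{w | ¬ Disjoint (G.neighborFinset v) (G.neighborFinset w)} ≤ d ^ 2 := by
  have hsub : (univ.filter fun w => ¬ Disjoint (G.neighborFinset v) (G.neighborFinset w)) ⊆
      (G.neighborFinset v).biUnion fun x => G.neighborFinset x := by
    intro w hw
    obtain ⟨x, hx, hx'⟩ := Finset.not_disjoint_iff.1 (mem_filter.1 hw).2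
    refine mem_biUnion.2 ⟨x, hx, ?_⟩
    rw [mem_neighborFinset] at hx' ⊢
    exact hx'.symm
  refine (card_le_card hsub).trans (card_biUnion_le.trans ?_)
  refine (sum_le_card_nsmul _ _ d fun x _ => hd x).trans ?_
  rw [smul_eq_mul, sq]
  exact Nat.mul_le_mul_right _ (hd v)

theorem exists_forall_balancedAt [DecidableEq V] (col : V → Fin k) (d : ℕ) (hk : 0 < k)
    (hM : 256 * k ^ 4 ≤ M) (hMd : M ^ 2 ≤ d) (hd : ∀ v, G.degree v ≤ d)
    (hexp : 4 * ((4 * k + 2) * Real.exp (-(M / 16))) * (d ^ 2 : ℕ) ≤ 1) :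
    ∃ ω : V → Fin M × Fin k × Bool, ∀ v, G.BalancedAt col d v ω := by
  classical
  have hMpos : 0 < M := lt_of_lt_of_le (by positivity) hM
  have : Nonempty (Fin M × Fin k × Bool) := ⟨(⟨0, hMpos⟩, ⟨0, hk⟩, true)⟩
  have hd1 : (1 : ℝ) ≤ (d ^ 2 : ℕ) := by
    have : 0 < d := lt_of_lt_of_le (by positivity) hMd
    exact_mod_cast Nat.one_le_pow _ _ this
  have hp0 : 0 ≤ (4 * k + 2) * Real.exp (-(M / 16 : ℝ)) := by positivity
  obtain ⟨ω, hω⟩ := exists_forall_notMem_of_local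
    (fun v => univ.filter fun ω : V → Fin M × Fin k × Bool => ¬ G.BalancedAt col d v ω)
    (fun v => G.neighborFinset v)
    (by
      intro v ω ω' h hb
      simp only [mem_filter, mem_univ, true_and] at hb ⊢
      exact fun hc => hb (hc.congr fun x hx => (h x hx).symm))
    (d ^ 2) (G.card_common_neighbor_le d hd) ((4 * k + 2) * Real.exp (-(M / 16))) hp0
    (by nlinarith) (fun v => G.card_not_balancedAt_le col d v hk hM hMd (hd v)) hexp
  exact ⟨ω, fun v => not_not.1 fun hc => hω v (mem_filter.2 ⟨mem_univ _, hc⟩)⟩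

end Labelling

end SimpleGraph

namespace SimpleGraph

open Finset

/-! ### Choice of savers and verification of the schedule. -/

section Assembly

variable {V : Type*} [Fintype V] (G : SimpleGraph V) [DecidableRel G.Adj]
variable {k M : ℕ}

/-- A system of `s` representatives for each member of a family, from Hall's theorem. -/
theorem exists_injective_representatives {ι α : Type*} [DecidableEq ι] [DecidableEq α]
    (t : ι → Finset α)
    (s : ℕ) (a b : ℝ) (hb : 0 < b) (hsab : s * b ≤ a) (hlarge : ∀ i, a ≤ #(t i))
    (hsparse : ∀ (Y : Finset ι) (u : α), (#{i ∈ Y | u ∈ t i} : ℝ) ≤ b) :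
    ∃ g : ι × Fin s → α, Function.Injective g ∧ ∀ i, g i ∈ t i.1 := by
  refine (Finset.all_card_le_biUnion_card_iff_exists_injective fun i : ι × Fin s => t i.1).1 ?_
  intro X
  set Y := X.image Prod.fst
  set U := X.biUnion fun i => t i.1
  have h1 : #X ≤ #Y * s := by
    have : X ⊆ Y ×ˢ univ := fun x hx => mem_product.2 ⟨mem_image_of_mem _ hx, mem_univ _⟩
    simpa using card_le_card this
  -- Hall's condition follows by counting incidences between `Y` and `U` in two ways.
  have h2 : #Y * a ≤ ∑ i ∈ Y, (#(t i) : ℝ) := by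
    simpa using card_nsmul_le_sum Y (fun i => (#(t i) : ℝ)) a fun i _ => hlarge i
  have h3 : ∑ i ∈ Y, #(t i) = ∑ u ∈ U, #{i ∈ Y | u ∈ t i} := by
    have := sum_card_bipartiteAbove_eq_sum_card_bipartiteBelow (s := Y) (t := U)
      (fun i u => u ∈ t i)
    simp only [bipartiteAbove, bipartiteBelow] at this
    rw [← this]
    refine sum_congr rfl fun i hi => ?_
    congr 1
    obtain ⟨x, hx, rfl⟩ := mem_image.1 hi
    ext u
    simp only [mem_filter]
    exact ⟨fun hu => ⟨mem_biUnion.2 ⟨x, hx, hu⟩, hu⟩, fun hu => hu.2⟩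
  have h4 : ∑ u ∈ U, (#{i ∈ Y | u ∈ t i} : ℝ) ≤ #U * b := by
    simpa using sum_le_card_nsmul U (fun u => (#{i ∈ Y | u ∈ t i} : ℝ)) b fun u _ => hsparse Y u
  have h3' : ∑ i ∈ Y, (#(t i) : ℝ) = ∑ u ∈ U, (#{i ∈ Y | u ∈ t i} : ℝ) := by exact_mod_cast h3
  have h1' : (#X : ℝ) ≤ #Y * s := by exact_mod_cast h1
  have h5 : #X * b ≤ #U * b := by
    calc #X * b ≤ #Y * s * b := mul_le_mul_of_nonneg_right h1' hb.le
      _ = #Y * (s * b) := by ring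
      _ ≤ #Y * a := mul_le_mul_of_nonneg_left hsab (Nat.cast_nonneg _)
      _ ≤ #U * b := h2.trans (h3'.trans_le h4)
  exact_mod_cast le_of_mul_le_mul_right h5 hb

theorem exists_degree_le_mul_card_color (col : V → Fin k) (hk : 0 < k) (v : V) :
    ∃ j, G.degree v ≤ k * #{x ∈ G.neighborFinset v | col x = j} := by
  have : Nonempty (Fin k) := ⟨⟨0, hk⟩⟩
  by_contra! h
  have h1 : G.degree v = ∑ j, #{x ∈ G.neighborFinset v | col x = j} := by
    rw [← card_neighborFinset_eq_degree]
    exact card_eq_sum_card_fiberwise fun _ _ => mem_univ _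
  have h2 : ∑ j : Fin k, k * #{x ∈ G.neighborFinset v | col x = j} < ∑ _j : Fin k, G.degree v :=
    sum_lt_sum_of_nonempty univ_nonempty fun j _ => h j
  rw [← mul_sum, ← h1] at h2
  simp at h2

/-- The time at which a vertex with color `c` and label `a` is removed: the reserve goes last, and
in each phase the vertices whose color is that of the phase go first. -/
def removalTime (c : Fin k) (a : Fin M × Fin k × Bool) : ℕ :=
  if a.1.val = 0 then 3 * k
  else if c = a.2.1 then 3 * a.2.1 + (if a.2.2 then 1 else 0) else 3 * a.2.1 + 2

theorem removalTime_lt_of_ne_zero (c : Fin k) (a : Fin M × Fin k × Bool) (h : a.1.val ≠ 0) :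
    removalTime c a < 3 * k := by
  have := a.2.1.2
  simp only [removalTime, h, if_false]
  split_ifs <;> omega

/-- The neighbors of `w` of color `j`, outside the reserve, labelled by the second half of phase
`j`. -/
def savers (col : V → Fin k) (ω : V → Fin M × Fin k × Bool) (j : Fin k) (w : V) : Finset V :=
  {x ∈ {x ∈ {x ∈ G.neighborFinset w | col x = j} | (ω x).2.1 = j ∧ (ω x).2.2 = true} |
    (ω x).1.val ≠ 0}

theorem mem_savers {col : V → Fin k} {ω : V → Fin M × Fin k × Bool} {j : Fin k} {w u : V} :
    u ∈ G.savers col ω j w ↔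
      G.Adj w u ∧ col u = j ∧ (ω u).2.1 = j ∧ (ω u).2.2 = true ∧ (ω u).1.val ≠ 0 := by
  simp only [savers, mem_filter, mem_neighborFinset]
  tauto

variable {G} {col : V → Fin k} {ω : V → Fin M × Fin k × Bool} {d s : ℕ}

/-- The unit of error is `δ = d / (32 k²)`: the reserve and `2 s` each cost at most `δ`, while half
a phase of the popular colour has expected size at least `8 δ`. -/
theorem reserve_and_color_bounds {n m : ℕ} (hk : 0 < k) (hM : 256 * k ^ 4 ≤ M)
    (hMd : M ^ 2 ≤ d) (hs : s * (24 * k ^ 2) ≤ M) (hn : d < n + s) (hm : n ≤ k * m) :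
    (3 * (d / M) : ℝ) ≤ d / (32 * k ^ 2) ∧ (2 * s : ℝ) < d / (32 * k ^ 2) ∧
      8 * (d / (32 * k ^ 2) : ℝ) ≤ 1 / (2 * k) * m := by
  have hk' : (0 : ℝ) < k := by exact_mod_cast hk
  have hMpos : 0 < M := lt_of_lt_of_le (by positivity) hM
  have hM' : (0 : ℝ) < M := by exact_mod_cast hMpos
  have hk2 : (1 : ℝ) ≤ k ^ 2 := by exact_mod_cast Nat.one_le_pow _ _ hk
  have hk4 : (256 * k ^ 2 : ℝ) ≤ M := by
    have : (256 * k ^ 4 : ℝ) ≤ M := by exact_mod_cast hM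
    nlinarith
  have hd' : (M ^ 2 : ℝ) ≤ d := by exact_mod_cast hMd
  have hs' : (s * (24 * k ^ 2) : ℝ) ≤ M := by exact_mod_cast hs
  have hsM : (24 * s : ℝ) ≤ M := by
    have : (0 : ℝ) ≤ s := Nat.cast_nonneg _
    nlinarith
  have hsd : (2 * s : ℝ) ≤ d := by nlinarith
  have hn' : (d : ℝ) ≤ n + s := by exact_mod_cast hn.le
  have hm' : (n : ℝ) ≤ k * m := by exact_mod_cast hm
  refine ⟨?_, ?_, ?_⟩
  · rw [← mul_div_assoc, div_le_div_iff₀ hM' (by positivity)]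
    have : (0 : ℝ) ≤ d := Nat.cast_nonneg _
    nlinarith
  · rw [lt_div_iff₀ (by positivity)]
    nlinarith
  · have h1 : (d : ℝ) ≤ 2 * (k * m) := by linarith
    have h2 : 8 * (d / (32 * k ^ 2) : ℝ) = 1 / (2 * k) * (d / (2 * k)) := by
      field_simp; ring
    rw [h2]
    refine mul_le_mul_of_nonneg_left ?_ (by positivity)
    rw [div_le_iff₀ (by positivity)]
    linarith

theorem BalancedAt.le_card_savers [DecidableEq V] {w : V} {j : Fin k} (hω : G.BalancedAt col d w ω)
    (hk : 0 < k) (hM : 256 * k ^ 4 ≤ M) (hMd : M ^ 2 ≤ d) (hs : s * (24 * k ^ 2) ≤ M)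
    (hw : d < G.degree w + s)
    (hj : G.degree w ≤ k * #{x ∈ G.neighborFinset w | col x = j}) :
    (d / (8 * k ^ 2) : ℝ) ≤ #(G.savers col ω j w) := by
  obtain ⟨h1, -, h3⟩ := reserve_and_color_bounds hk hM hMd hs hw hj
  have h4 := hω.le_class j true
  have h5 := hω.reserve_le
  have h6 : #{x ∈ {x ∈ G.neighborFinset w | col x = j} | (ω x).2.1 = j ∧ (ω x).2.2 = true} ≤
      #(G.savers col ω j w) + #{x ∈ G.neighborFinset w | (ω x).1.val = 0} := by
    refine (card_le_card fun x hx => ?_).trans (card_union_le _ _)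
    by_cases hx0 : (ω x).1.val = 0
    · exact mem_union_right _ (mem_filter.2
        ⟨(mem_filter.1 (mem_filter.1 hx).1).1, hx0⟩)
    · exact mem_union_left _ (mem_filter.2 ⟨hx, hx0⟩)
  have h6' : (#{x ∈ {x ∈ G.neighborFinset w | col x = j} |
      (ω x).2.1 = j ∧ (ω x).2.2 = true} : ℝ) ≤
      #(G.savers col ω j w) + #{x ∈ G.neighborFinset w | (ω x).1.val = 0} := by exact_mod_cast h6
  have h7 : (d / (8 * k ^ 2) : ℝ) = 4 * (d / (32 * k ^ 2)) := by ring
  have h8 : (0 : ℝ) ≤ d / (32 * k ^ 2) := by positivity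
  linarith

/-- The first half of the phase contributes at least `7 δ` at `w`, with `δ = d / (32 k²)`. Against
it stand `2 δ` from the early counts, less than `δ` from `s` and the degree gap, and `δ` from the
reserve. -/
theorem BalancedAt.removed_lt {u w : V} {j : Fin k} (hu : G.BalancedAt col d u ω)
    (hω : G.BalancedAt col d w ω) (hdu : G.degree u ≤ d)
    (hk : 0 < k) (hM : 256 * k ^ 4 ≤ M) (hMd : M ^ 2 ≤ d) (hs : s * (24 * k ^ 2) ≤ M)
    (hw : d < G.degree w + s)
    (hj : G.degree w ≤ k * #{x ∈ G.neighborFinset w | col x = j}) :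
    #{x ∈ G.neighborFinset u | (ω x).2.1 < j} + s + #{x ∈ G.neighborFinset w | (ω x).1.val = 0} <
      #{x ∈ G.neighborFinset w | (ω x).2.1 < j} +
      #{x ∈ {x ∈ G.neighborFinset w | col x = j} | (ω x).2.1 = j ∧ (ω x).2.2 = false} := by
  obtain ⟨h1, h2, h3⟩ := reserve_and_color_bounds hk hM hMd hs hw hj
  have h4 := hω.le_class j false
  have h5 := hω.reserve_le
  have h6 := hω.le_early j
  have h7 := hu.early_le j
  have hk' : (0 : ℝ) < k := by exact_mod_cast hk
  have hjk : (j.val / k : ℝ) ≤ 1 := by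
    rw [div_le_one hk']; exact_mod_cast j.2.le
  have hjk0 : (0 : ℝ) ≤ j.val / k := by positivity
  have h8 : (j.val / k : ℝ) * G.degree u ≤ (j.val / k : ℝ) * G.degree w + s := by
    have hdw : (G.degree u : ℝ) ≤ G.degree w + s := by exact_mod_cast hdu.trans hw.le
    have := mul_le_mul_of_nonneg_left hdw hjk0
    have : (j.val / k : ℝ) * s ≤ s := mul_le_of_le_one_left (Nat.cast_nonneg _) hjk
    linarith
  rw [← Nat.cast_lt (α := ℝ)]
  push_cast
  linarith

theorem weaklyDegenerate_of_balancedAt [DecidableEq V]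
    (hcol : ∀ u v, G.Adj u v → col u ≠ col v) (hk : 0 < k) (hM : 256 * k ^ 4 ≤ M)
    (hMd : M ^ 2 ≤ d) (hs : s * (24 * k ^ 2) ≤ M)
    (hd : ∀ v, G.degree v ≤ d) (hω : ∀ v, G.BalancedAt col d v ω) :
    G.WeaklyDegenerate fun _ => d - s := by
  have hMpos : 0 < M := lt_of_lt_of_le (by positivity) hM
  have hsM : s * 24 ≤ M := le_trans (Nat.mul_le_mul_left _ (by nlinarith)) hs
  have hsd : 2 * s ≤ d := by nlinarith
  choose j hj using G.exists_degree_le_mul_card_color col hk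
  let needy : V → Prop := fun w => (ω w).1.val = 0 ∧ d < G.degree w + s
  let t : {w // needy w} → Finset V := fun w => G.savers col ω (j w) w
  obtain ⟨g, hginj, hgmem⟩ : ∃ g : {w // needy w} × Fin s → V,
      Function.Injective g ∧ ∀ i, g i ∈ t i.1 := by
    have hM' : (0 : ℝ) < M := by exact_mod_cast hMpos
    have hd' : (0 : ℝ) < d := by
      exact_mod_cast lt_of_lt_of_le (show 0 < M ^ 2 by positivity) hMd
    have hk' : (0 : ℝ) < k := by exact_mod_cast hk
    -- The requirement `s * (3 d / M) ≤ d / (8 k²)` amounts to `hs`.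
    refine exists_injective_representatives t s (d / (8 * k ^ 2)) (3 * (d / M)) (by positivity)
      ?_ (fun w => (hω w).le_card_savers hk hM hMd hs w.2.2 (hj w)) fun Y u => ?_
    · have hs' : (s * (24 * k ^ 2) : ℝ) ≤ M := by exact_mod_cast hs
      rw [le_div_iff₀ (by positivity)]
      have h1 := mul_le_mul_of_nonneg_right hs' (show (0 : ℝ) ≤ d / M by positivity)
      have h2 : (M : ℝ) * (d / M) = d := by field_simp
      linarith
    · refine le_trans ?_ (hω u).reserve_le
      refine Nat.cast_le.2 (card_le_card_of_injOn Subtype.val (fun w hw => ?_)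
        Subtype.val_injective.injOn)
      have hu := (G.mem_savers).1 (mem_filter.1 hw).2
      exact mem_filter.2 ⟨(G.mem_neighborFinset _ _).2 hu.1.symm, w.2.1⟩
  have hsav : ∃ sav : V → Option V, ∀ u w, sav u = some w ↔ ∃ i, (g i = u ∧ i.1.1 = w) := by
    classical
    refine ⟨fun u => if h : ∃ i, g i = u then some h.choose.1.1 else none, fun u w => ?_⟩
    by_cases h : ∃ i, g i = u
    · simp only [h, dif_pos, Option.some.injEq]
      constructor
      · exact fun hw => ⟨_, h.choose_spec, hw⟩
      · rintro ⟨i, hi, hw⟩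
        rw [← hw, hginj (h.choose_spec.trans hi.symm)]
    · simp only [h, dif_neg, not_false_eq_true, reduceCtorEq, false_iff]
      exact fun ⟨i, hi, _⟩ => h ⟨i, hi⟩
  obtain ⟨sav, hsav⟩ := hsav
  have hsavers : ∀ u w, sav u = some w → needy w ∧ u ∈ G.savers col ω (j w) w := by
    intro u w h
    obtain ⟨i, rfl, rfl⟩ := (hsav u w).1 h
    exact ⟨i.1.2, hgmem i⟩
  have hcount : ∀ w, needy w → #{x | sav x = some w} = s := by
    intro w hw
    have : (univ.filter fun x => sav x = some w)
        = (univ : Finset (Fin s)).image fun i => g (⟨w, hw⟩, i) := by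
      ext x
      simp only [mem_filter, mem_univ, true_and, mem_image, hsav]
      constructor
      · rintro ⟨⟨⟨w', h'⟩, i⟩, h1, rfl⟩
        exact ⟨i, h1⟩
      · rintro ⟨i, hi⟩
        exact ⟨_, hi, rfl⟩
    rw [this, card_image_of_injective _ fun a b hab => by simpa using hginj hab]
    simp
  have hres : ∀ v, d < G.degree v + s → s ≤ #{x ∈ G.neighborFinset v | (ω x).1.val = 0} := by
    intro v hv
    have h2 : (d : ℝ) ≤ 2 * G.degree v := by
      exact_mod_cast (show d ≤ 2 * G.degree v by omega)
    have h3 := (hω v).le_reserve h2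
    have hM' : (0 : ℝ) < M := by exact_mod_cast hMpos
    have h4 : (M : ℝ) ≤ d / M := by
      rw [le_div_iff₀ hM']
      have : (M ^ 2 : ℝ) ≤ d := by exact_mod_cast hMd
      nlinarith
    have h5 : (s * 24 : ℝ) ≤ M := by exact_mod_cast hsM
    have h6 : (s : ℝ) ≤ #{x ∈ G.neighborFinset v | (ω x).1.val = 0} := by
      have : (0 : ℝ) ≤ s := by positivity
      linarith
    exact_mod_cast h6
  let τ : V → ℕ := fun v => removalTime (col v) (ω v)
  have hmain := G.removable_of_schedule τ (fun _ => ((d - s : ℕ) : ℤ)) sav ?_ ?_ ?_ univ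
    (fun x hx => absurd (mem_univ x) hx)
  · have hfun : G.scheduleFun (fun _ => ((d - s : ℕ) : ℤ)) sav univ
        = fun _ => ((d - s : ℕ) : ℤ) := by
      funext v; simp [scheduleFun]
    rw [hfun, coe_univ] at hmain
    exact hmain
  · intro u w h
    obtain ⟨hw, hu⟩ := hsavers u w h
    rw [mem_savers] at hu
    refine ⟨hu.1.symm, ?_⟩
    have h1 : τ w = 3 * k := by simp [τ, removalTime, hw.1]
    rw [h1]
    exact removalTime_lt_of_ne_zero _ _ hu.2.2.2.2
  · intro S hS v hv
    have hrem : #{x | G.Adj v x ∧ x ∉ S} + #{x ∈ G.neighborFinset v | x ∈ S} = G.degree v := by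
      rw [← card_neighborFinset_eq_degree, add_comm,
        ← card_filter_add_card_filter_not (s := G.neighborFinset v) (p := fun x => x ∈ S)]
      congr 2
      ext x; simp
    simp only [scheduleFun]
    have hdv := hd v
    by_cases hdeg : d < G.degree v + s
    · by_cases hr : (ω v).1.val = 0
      · have h1 := hcount v ⟨hr, hdeg⟩
        -- Savers still in `S` have not yet saved `v`, but they are remaining neighbours, whose
        -- removal has not been charged to `v` either.
        have h2 : #{x | sav x = some v ∧ x ∈ S} + #{x | sav x = some v ∧ x ∉ S}
            = #{x | sav x = some v} := by
          rw [← filter_filter, ← filter_filter]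
          exact card_filter_add_card_filter_not _
        have h3 : #{x | sav x = some v ∧ x ∈ S} ≤ #{x ∈ G.neighborFinset v | x ∈ S} := by
          refine card_le_card fun x hx => ?_
          simp only [mem_filter, mem_univ, true_and, mem_neighborFinset] at hx ⊢
          exact ⟨((G.mem_savers).1 (hsavers x v hx.1).2).1, hx.2⟩
        omega
      · have h1 := hres v hdeg
        have h2 : #{x ∈ G.neighborFinset v | (ω x).1.val = 0} ≤
            #{x ∈ G.neighborFinset v | x ∈ S} := by
          refine card_le_card fun x hx => ?_
          simp only [mem_filter] at hx ⊢
          refine ⟨hx.1, ?_⟩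
          by_contra hxS
          have h3 := hS x hxS v hv
          have h4 : τ x = 3 * k := by simp [τ, removalTime, hx.2]
          have h5 : τ v < 3 * k := removalTime_lt_of_ne_zero _ _ hr
          omega
        omega
    · omega
  · intro S hS u hu hmin w hsu
    obtain ⟨hw, hsw⟩ := hsavers u w hsu
    rw [mem_savers] at hsw
    obtain ⟨hadj, hcu, hyu, hhu, hru⟩ := hsw
    have hτu : τ u = 3 * (j w).val + 1 := by
      simp [τ, removalTime, hru, hcu, hyu, hhu]
    -- In phase `j w` only vertices of the colour of `u` can have left so far, and none of them is
    -- adjacent to `u`.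
    have h1 : #{x | G.Adj u x ∧ x ∉ S} ≤ #{x ∈ G.neighborFinset u | (ω x).2.1 < j w} := by
      refine card_le_card fun x hx => ?_
      simp only [mem_filter, mem_univ, true_and, mem_neighborFinset] at hx ⊢
      refine ⟨hx.1, ?_⟩
      have h2 := hS x hx.2 u hu
      rw [hτu] at h2
      have h3 := hcol u x hx.1
      rw [hcu] at h3
      simp only [τ, removalTime] at h2
      rw [Fin.lt_def]
      have h4 := (j w).2
      split_ifs at h2 with ha hb hc
      · omega
      · by_contra hlt
        exact h3 (hb ▸ Fin.ext (by omega))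
      · by_contra hlt
        exact h3 (hb ▸ Fin.ext (by omega))
      · omega
    -- Reserve vertices carry a phase label too but are still present, hence the last term.
    have h2 : #{x ∈ G.neighborFinset w | (ω x).2.1 < j w} +
        #{x ∈ {x ∈ G.neighborFinset w | col x = j w} | (ω x).2.1 = j w ∧ (ω x).2.2 = false} ≤
        #{x | G.Adj w x ∧ x ∉ S} + #{x ∈ G.neighborFinset w | (ω x).1.val = 0} := by
      rw [← card_union_of_disjoint]
      · refine (card_le_card fun x hx => ?_).trans (card_union_le _ _)
        simp only [mem_union, mem_filter, mem_univ, true_and, mem_neighborFinset] at hx ⊢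
        by_cases hrx : (ω x).1.val = 0
        · rcases hx with hx | hx
          · exact Or.inr ⟨hx.1, hrx⟩
          · exact Or.inr ⟨hx.1.1, hrx⟩
        · left
          have hτx : τ x < τ u := by
            rw [hτu]
            simp only [τ, removalTime, hrx, if_false]
            rcases hx with hx | hx
            · have := Fin.lt_def.1 hx.2
              split_ifs <;> omega
            · simp [hx.1.2, hx.2.1, hx.2.2]
          refine ⟨by tauto, fun hxS => ?_⟩
          have := hmin x hxS
          omega
      · rw [Finset.disjoint_left]
        intro x hx hx'
        simp only [mem_filter] at hx hx'
        exact absurd hx'.2.1 hx.2.ne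
    have h3 : #{x | sav x = some w ∧ x ∉ S} ≤ s := by
      rw [← hcount w hw]
      exact card_le_card fun x hx => by
        simp only [mem_filter, mem_univ, true_and] at hx ⊢; exact hx.1
    have h4 := (hω u).removed_lt (hω w) (hd u) hk hM hMd hs hw.2 (hj w)
    simp only [scheduleFun]
    omega

/-- The local lemma condition holds for large `M` since `d² ≤ 16 M⁴` and `M⁴ exp (-M / 16)` tends to
`0`. -/
theorem eventually_exp_bound (k : ℕ) : ∃ M₀ : ℕ, ∀ M d : ℕ, M₀ ≤ M → d ≤ 4 * M ^ 2 →
    4 * ((4 * k + 2) * Real.exp (-(M / 16))) * (d ^ 2 : ℕ) ≤ (1 : ℝ) := by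
  have h := (Real.tendsto_pow_mul_exp_neg_atTop_nhds_zero 4).comp
    ((tendsto_natCast_atTop_atTop (R := ℝ)).atTop_div_const (show (0 : ℝ) < 16 by norm_num))
  have hpos : (0 : ℝ) < 1 / (4 * (4 * k + 2) * 16 * 16 ^ 4) := by positivity
  obtain ⟨M₀, hM₀⟩ := Filter.eventually_atTop.1 (h.eventually (gt_mem_nhds hpos))
  refine ⟨M₀, fun M d hM hd => ?_⟩
  have h1 := hM₀ M hM
  simp only [Function.comp_apply] at h1
  rw [lt_div_iff₀ (by positivity)] at h1
  have h2 : ((d ^ 2 : ℕ) : ℝ) ≤ 16 * (M : ℝ) ^ 4 := by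
    have : d ^ 2 ≤ 16 * M ^ 4 := (Nat.pow_le_pow_left hd 2).trans_eq (by ring)
    exact_mod_cast this
  refine le_trans (mul_le_mul_of_nonneg_left h2 (by positivity)) (le_trans (le_of_eq ?_) h1.le)
  ring

end Assembly

end SimpleGraph

theorem theorem1p9 (k : ℕ) (hk : 1 ≤ k) :
    ∃ c : ℝ, 0 < c ∧ ∃ d₀ : ℕ,
      ∀ (V : Type*) [Fintype V] (G : SimpleGraph V) [DecidableRel G.Adj] (d : ℕ),
        G.maxDegree = d → d₀ ≤ d → G.chromaticNumber ≤ (k : ℕ∞) →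
          (G.weakDegeneracy : ℝ) ≤ (d : ℝ) - c * Real.sqrt (d : ℝ) := by
  obtain ⟨M₀, hM₀⟩ := SimpleGraph.eventually_exp_bound k
  have hk' : (0 : ℝ) < k := by exact_mod_cast hk
  -- The constant comes from `√d ≤ 2 M` and `M ≤ 48 k² s`; each factor `2` absorbs a rounding.
  refine ⟨1 / (96 * k ^ 2), by positivity, (M₀ + 256 * k ^ 4) ^ 2, ?_⟩
  intro V _ G _ d hmax hd hχ
  classical
  set M := Nat.sqrt d
  have hMge : M₀ + 256 * k ^ 4 ≤ M := Nat.le_sqrt'.2 hd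
  have hM : 256 * k ^ 4 ≤ M := by omega
  have hMd : M ^ 2 ≤ d := Nat.sqrt_le' d
  have hMpos : 0 < M := lt_of_lt_of_le (by positivity) hM
  have hdM : d < (M + 1) ^ 2 := Nat.lt_succ_sqrt' d
  have hdM4 : d ≤ 4 * M ^ 2 := by nlinarith
  have hdeg : ∀ v, G.degree v ≤ d := fun v => hmax ▸ G.degree_le_maxDegree v
  obtain ⟨C⟩ := SimpleGraph.chromaticNumber_le_iff_colorable.1 hχ
  obtain ⟨ω, hω⟩ := G.exists_forall_balancedAt (fun v => C v) d hk hM hMd hdeg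
    (hM₀ M d (by omega) hdM4)
  set s := M / (24 * k ^ 2)
  have hs : s * (24 * k ^ 2) ≤ M := Nat.div_mul_le_self _ _
  have hwd : G.weakDegeneracy ≤ d - s := Nat.sInf_le
    (SimpleGraph.weaklyDegenerate_of_balancedAt (fun u v h => C.valid h) hk hM hMd hs hdeg hω)
  have hk2 : 1 ≤ k ^ 2 := Nat.one_le_pow _ _ hk
  have hsd : s ≤ d := (Nat.div_le_self _ _).trans (by nlinarith)
  have hM24 : 24 * k ^ 2 ≤ M := le_trans (by nlinarith) hM
  have hs1 : 1 ≤ s := (Nat.one_le_div_iff (by positivity)).2 hM24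
  have hs2 : M ≤ 2 * (s * (24 * k ^ 2)) := by
    have h1 : M < (24 * k ^ 2) * (s + 1) := Nat.lt_mul_div_succ M (by positivity)
    nlinarith
  have hsqrt : Real.sqrt d ≤ 2 * M := by
    rw [Real.sqrt_le_left (by positivity)]
    have : (d : ℝ) ≤ 4 * M ^ 2 := by exact_mod_cast hdM4
    linarith
  have hfin : 1 / (96 * k ^ 2) * Real.sqrt d ≤ s := by
    rw [one_div_mul_eq_div, div_le_iff₀ (by positivity)]
    have : (M : ℝ) ≤ 2 * (s * (24 * k ^ 2)) := by exact_mod_cast hs2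
    linarith
  have hwd' : (G.weakDegeneracy : ℝ) ≤ d - s := by
    rw [← Nat.cast_sub hsd]; exact_mod_cast hwd
  linarith
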